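/- There are absolute constants $0 < c$ and $0 < C$ such that the following holds for every positive integer $n$ and every real $\varepsilon$ with $0<\varepsilon<1/2$ and $1/\varepsilon^2 < n/2$. (Upper bound.) There are a natural number $m \le C\,\varepsilon^{-2}\log(\varepsilon^2 n)$, a matrix $A\in\mathbb{R}^{m\times n}$ and an output procedure (a function) $Out:\mathbb{R}^m\to\mathbb{R}$ such that for every $x\in\mathbb{R}^n$ $$\|x\|_2-\varepsilon\|x\|_1\;\le\; Out(Ax)\;\le\;\|x\|_2+\varepsilon\|x\|_1 .$$ (Tightness.) If $m$ is a natural number with $m < c\,\varepsilon^{-2}\log(\varepsilon^2 n)$, then no matrix $A\in\mathbb{R}^{m\times n}$ and function $Out:\mathbb{R}^m\to\mathbb{R}$ satisfy these inequalities for all $x\in\mathbb{R}^n$. In other words, the minimum number of rows for deterministic $\ell_2$ norm estimation with additive error $\varepsilon\|x\|_1$ is $\Theta(\varepsilon^{-2}\log(\varepsilon^2 n))$. -/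

import Mathlib

open scoped ENNReal Matrix

/-- The `ℓ_p` norm of a vector in `ℝⁿ`. -/
noncomputable def lpNormVec {n : ℕ} (p : ℝ≥0∞) (x : Fin n → ℝ) : ℝ :=
  ‖WithLp.toLp p x‖

/-- The pair `(A, Out)` solves the `ℓ₂` norm estimation problem in `ℝⁿ` with error parameter `ε`:
for every `x`, the procedure `Out`, which is given only the sketch `A x`, returns a number in
`[‖x‖₂ - ε ‖x‖₁, ‖x‖₂ + ε ‖x‖₁]`. -/
def SolvesL2NormEstimation {m n : ℕ} (A : Matrix (Fin m) (Fin n) ℝ)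
    (Out : (Fin m → ℝ) → ℝ) (ε : ℝ) : Prop :=
  ∀ x : Fin n → ℝ,
    lpNormVec 2 x - ε * lpNormVec 1 x ≤ Out (A *ᵥ x) ∧
      Out (A *ᵥ x) ≤ lpNormVec 2 x + ε * lpNormVec 1 x

/-! An output procedure exists exactly when every `z` in the kernel of `A` satisfies `‖z‖₂ ≤ ε
‖z‖₁`, so the question is how small the codimension of such a subspace can be.

Tightness: Cauchy–Schwarz shows that such a kernel vector has only a fixed fraction of its `ℓ₁` mass
on any `O(ε⁻²)` coordinates, so sparse vectors keep their `ℓ₁` norm, up to a constant, in the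
quotient of `ℓ₁ⁿ` by the kernel (`le_lpNormVec_one_sub`). A Gilbert–Varshamov code of `s`-sparse
indicators with `s ≈ ε⁻²/4` (`exists_code`) thus becomes a separated set in a ball of a normed space
of dimension at most `m`. Comparing volumes gives `(√q / 2) ^ s ≤ 29 ^ m` with `q ≈ n / s`
(`card_code_le`); taking logarithms gives the bound.

Upper bound: by Chernoff and a union bound, some sign matrix distorts the norm of every integer
vector with `‖k‖₁ ≤ L` by at most a constant factor, as a map from `ℓ₂` to `ℓ₁`
(`exists_matrix_int_vectors`). Scale a kernel vector to `ℓ₁` norm `L` and split it as `k + f`, with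
`k` its rounding towards zero. Both `‖f‖₂` and `‖A f‖₁ / m` are `O(√L)`, and `A k = -A f`, so `‖k‖₂`
is `O(√L)` too (`lpNormVec_two_le_of_mulVec_eq_zero`). Hence `‖z‖₂ = O(‖z‖₁ / √L)` on the kernel,
and `L ≈ ε⁻²` suffices. -/

theorem lpNormVec_one_eq {n : ℕ} (x : Fin n → ℝ) : lpNormVec 1 x = ∑ i, |x i| := by
  simp [lpNormVec, PiLp.norm_eq_of_L1]

theorem lpNormVec_two_eq {n : ℕ} (x : Fin n → ℝ) : lpNormVec 2 x = √(∑ i, x i ^ 2) := by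
  simp [lpNormVec, PiLp.norm_eq_of_L2]

theorem lpNormVec_add_le {n : ℕ} (p : ℝ≥0∞) [Fact (1 ≤ p)] (x y : Fin n → ℝ) :
    lpNormVec p (x + y) ≤ lpNormVec p x + lpNormVec p y := by
  simpa [lpNormVec, WithLp.toLp_add] using norm_add_le (WithLp.toLp p x) (WithLp.toLp p y)

theorem lpNormVec_sub_le {n : ℕ} (p : ℝ≥0∞) [Fact (1 ≤ p)] (x y : Fin n → ℝ) :
    lpNormVec p (x - y) ≤ lpNormVec p x + lpNormVec p y := by
  simpa [lpNormVec, WithLp.toLp_sub] using norm_sub_le (WithLp.toLp p x) (WithLp.toLp p y)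

theorem lpNormVec_smul {n : ℕ} (p : ℝ≥0∞) [Fact (1 ≤ p)] (c : ℝ) (x : Fin n → ℝ) :
    lpNormVec p (c • x) = |c| * lpNormVec p x := by
  simp [lpNormVec, WithLp.toLp_smul, norm_smul]

theorem lpNormVec_zero {n : ℕ} (p : ℝ≥0∞) [Fact (1 ≤ p)] :
    lpNormVec p (0 : Fin n → ℝ) = 0 := by
  simp [lpNormVec]

/-! ### Reduction to a condition on the kernel -/

/-- A sketch `A` admits an output procedure if and only if its kernel contains no vector whose
`ℓ₂` norm exceeds `ε` times its `ℓ₁` norm. -/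
theorem exists_solvesL2NormEstimation_iff {m n : ℕ} (A : Matrix (Fin m) (Fin n) ℝ) {ε : ℝ}
    (hε : 0 ≤ ε) :
    (∃ Out : (Fin m → ℝ) → ℝ, SolvesL2NormEstimation A Out ε) ↔
      ∀ z : Fin n → ℝ, A *ᵥ z = 0 → lpNormVec 2 z ≤ ε * lpNormVec 1 z := by
  constructor
  · rintro ⟨Out, h⟩ z hz
    have h1 := (h z).1
    have h0 := (h 0).2
    rw [hz] at h1
    simp only [Matrix.mulVec_zero, lpNormVec_zero, mul_zero, add_zero] at h0
    linarith
  · intro h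
    have key : ∀ x x' : Fin n → ℝ, A *ᵥ x = A *ᵥ x' →
        lpNormVec 2 x - ε * lpNormVec 1 x ≤ lpNormVec 2 x' + ε * lpNormVec 1 x' := by
      intro x x' hx
      have h1 := h (x - x') (by rw [Matrix.mulVec_sub, hx, sub_self])
      have h2 := lpNormVec_add_le 2 (x - x') x'
      have h3 := mul_le_mul_of_nonneg_left (lpNormVec_sub_le 1 x x') hε
      rw [sub_add_cancel] at h2
      linarith
    -- The largest lower bound over the fibre of `y`; by `key` it is at most every upper bound over
    -- the same fibre.
    refine ⟨fun y => sSup ((fun x => lpNormVec 2 x - ε * lpNormVec 1 x) '' {x | A *ᵥ x = y}),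
      fun x => ⟨?_, ?_⟩⟩
    · refine le_csSup ⟨lpNormVec 2 x + ε * lpNormVec 1 x, ?_⟩ ⟨x, rfl, rfl⟩
      rintro _ ⟨x', hx', rfl⟩
      exact key x' x hx'
    · refine csSup_le ⟨_, x, rfl, rfl⟩ ?_
      rintro _ ⟨x', hx', rfl⟩
      exact key x' x hx'

/-! ### Tightness: codes and packing in a quotient of `ℓ₁` -/

open MeasureTheory Metric in
/-- Volume bound for a `δ`-separated subset of the ball of radius `R`. -/
theorem card_le_of_norm_le_of_separated {E : Type*} [NormedAddCommGroup E] [NormedSpace ℝ E]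
    [FiniteDimensional ℝ E] (s : Finset E) {R δ : ℝ} (hδ : 0 < δ) (hR : 0 ≤ R)
    (hs : ∀ c ∈ s, ‖c‖ ≤ R) (h : ∀ c ∈ s, ∀ d ∈ s, c ≠ d → δ ≤ ‖c - d‖) :
    (s.card : ℝ) ≤ ((R + δ / 2) / (δ / 2)) ^ Module.finrank ℝ E := by
  borelize E
  let μ : Measure E := Measure.addHaar
  have hρ : 0 < R + δ / 2 := by positivity
  set A := ⋃ c ∈ s, ball (c : E) (δ / 2) with hA
  have D : Set.Pairwise (s : Set E) (Function.onFun Disjoint fun c => ball (c : E) (δ / 2)) := by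
    rintro c hc d hd hcd
    apply ball_disjoint_ball
    rw [dist_eq_norm]
    convert h c hc d hd hcd
    ring
  have A_subset : A ⊆ ball (0 : E) (R + δ / 2) := by
    refine Set.iUnion₂_subset fun x hx => ?_
    apply ball_subset_ball'
    rw [dist_zero_right]
    linarith [hs x hx]
  have I : (s.card : ℝ≥0∞) * ENNReal.ofReal ((δ / 2) ^ Module.finrank ℝ E) * μ (ball 0 1) ≤
      ENNReal.ofReal ((R + δ / 2) ^ Module.finrank ℝ E) * μ (ball 0 1) := by
    calc
      _ = μ A := by
        rw [hA, measure_biUnion_finset D fun c _ => measurableSet_ball]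
        simp only [μ.addHaar_ball_of_pos _ (half_pos hδ), Finset.sum_const, nsmul_eq_mul, mul_assoc]
      _ ≤ μ (ball (0 : E) (R + δ / 2)) := measure_mono A_subset
      _ = _ := by simp only [μ.addHaar_ball_of_pos _ hρ]
  have J : (s.card : ℝ≥0∞) * ENNReal.ofReal ((δ / 2) ^ Module.finrank ℝ E) ≤
      ENNReal.ofReal ((R + δ / 2) ^ Module.finrank ℝ E) :=
    (ENNReal.mul_le_mul_iff_left (measure_ball_pos _ _ zero_lt_one).ne'
      measure_ball_lt_top.ne).1 I
  rw [div_pow, le_div_iff₀ (by positivity)]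
  rw [← ENNReal.ofReal_natCast, ← ENNReal.ofReal_mul (by positivity),
    ENNReal.ofReal_le_ofReal_iff (by positivity)] at J
  exact J

/-- Gilbert–Varshamov bound: there are many words of length `s` over an alphabet with `q` letters
with pairwise Hamming distance at least `s / 2`. -/
theorem exists_code (s q : ℕ) (hq : 0 < q) :
    ∃ T : Finset (Fin s → Fin q), (∀ f ∈ T, ∀ g ∈ T, f ≠ g → s ≤ 2 * hammingDist f g) ∧
      (√q / 2) ^ s ≤ T.card := by
  classical
  -- A code maximal under inclusion: any word farther than `s / 2` from all codewords could be
  -- added.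
  obtain ⟨T, hT⟩ := (Set.toFinite {T : Finset (Fin s → Fin q) |
    ∀ f ∈ T, ∀ g ∈ T, f ≠ g → s ≤ 2 * hammingDist f g}).exists_maximal ⟨∅, by simp⟩
  refine ⟨T, hT.1, ?_⟩
  have hq' : (0 : ℝ) < q := by exact_mod_cast hq
  have hsq : 0 < √(q : ℝ) := Real.sqrt_pos.2 hq'
  have cover : ∀ g : Fin s → Fin q, ∃ f ∈ T, 2 * hammingDist f g ≤ s := by
    intro g
    by_contra! hg
    have hmem : insert g T ⊆ T := hT.2 (y := insert g T) (by
      intro a ha b hb hab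
      rcases Finset.mem_insert.1 ha with ha' | ha' <;> rcases Finset.mem_insert.1 hb with hb' | hb'
      · exact absurd (ha'.trans hb'.symm) hab
      · rw [ha', hammingDist_comm]; exact (hg b hb').le
      · rw [hb']; exact (hg a ha').le
      · exact hT.1 a ha' b hb' hab) (Finset.subset_insert _ _)
    have := hg g (hmem (Finset.mem_insert_self _ _))
    simp at this
  -- Instead of counting a Hamming ball, weight `g` by `√q ^ s * q ^ (-dist)`, which is at least `1`
  -- inside the ball. The sum over all words factorises, and each coordinate contributes at most
  -- `2`.
  have ball : ∀ f : Fin s → Fin q,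
      ∑ g : Fin s → Fin q, √(q : ℝ) ^ s * (1 / q : ℝ) ^ hammingDist f g ≤ √(q : ℝ) ^ s * 2 ^ s := by
    intro f
    rw [← Finset.mul_sum]
    refine mul_le_mul_of_nonneg_left ?_ (by positivity)
    have e : ∀ g : Fin s → Fin q, (1 / q : ℝ) ^ hammingDist f g =
        ∏ i, (if f i ≠ g i then (1 / q : ℝ) else 1) := by
      intro g
      rw [Finset.prod_ite]
      simp [hammingDist]
    simp_rw [e]
    rw [← Fintype.piFinset_univ, ← Finset.prod_univ_sum (fun _ => Finset.univ)
      (fun i a => if f i ≠ a then (1 / q : ℝ) else 1)]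
    calc _ ≤ ∏ _i : Fin s, (2 : ℝ) := by
          refine Finset.prod_le_prod (fun i _ => Finset.sum_nonneg fun a _ => ?_) fun i _ => ?_
          · split_ifs <;> positivity
          · calc _ ≤ ∑ a : Fin q, ((1 / q : ℝ) + if f i = a then 1 else 0) := by
                  refine Finset.sum_le_sum fun a _ => ?_
                  by_cases h : f i = a <;> simp [h]
              _ = 2 := by
                  rw [Finset.sum_add_distrib]
                  simp
                  field_simp
                  norm_num
      _ = 2 ^ s := by simp
  have count : (q : ℝ) ^ s ≤ T.card * (√(q : ℝ) ^ s * 2 ^ s) := by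
    calc (q : ℝ) ^ s = ∑ _g : Fin s → Fin q, (1 : ℝ) := by simp
      _ ≤ ∑ g : Fin s → Fin q, ∑ f ∈ T, √(q : ℝ) ^ s * (1 / q : ℝ) ^ hammingDist f g := by
        refine Finset.sum_le_sum fun g _ => ?_
        obtain ⟨f, hf, hfg⟩ := cover g
        refine le_trans ?_ (Finset.single_le_sum
          (f := fun f => √(q : ℝ) ^ s * (1 / q : ℝ) ^ hammingDist f g)
          (fun _ _ => by positivity) hf)
        have h1 : (1 : ℝ) ≤ √(q : ℝ) := Real.one_le_sqrt.2 (by exact_mod_cast hq)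
        have h2 : (1 / q : ℝ) ^ hammingDist f g * √(q : ℝ) ^ (2 * hammingDist f g) = 1 := by
          rw [pow_mul, Real.sq_sqrt hq'.le, ← mul_pow]
          simp [hq'.ne']
        have h3 := pow_le_pow_right₀ h1 hfg
        have h4 : (0 : ℝ) ≤ (1 / q : ℝ) ^ hammingDist f g := by positivity
        nlinarith [mul_le_mul_of_nonneg_left h3 h4]
      _ = ∑ f ∈ T, ∑ g : Fin s → Fin q, √(q : ℝ) ^ s * (1 / q : ℝ) ^ hammingDist f g :=
        Finset.sum_comm
      _ ≤ ∑ _f ∈ T, √(q : ℝ) ^ s * 2 ^ s := Finset.sum_le_sum fun f _ => ball f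
      _ = _ := by simp
  have hs : (q : ℝ) ^ s = √(q : ℝ) ^ s * √(q : ℝ) ^ s := by
    rw [← mul_pow, Real.mul_self_sqrt hq'.le]
  rw [div_pow, div_le_iff₀ (by positivity)]
  refine le_of_mul_le_mul_left ?_ (show (0 : ℝ) < √(q : ℝ) ^ s by positivity)
  linarith

/-- If all vectors `z` of a set satisfy `‖z‖₂ ≤ ε ‖z‖₁`, then a sparse vector `d` cannot be
approximated well in the `ℓ₁` norm by elements of this set. -/
theorem le_lpNormVec_one_sub {n : ℕ} {ε : ℝ} (S : Finset (Fin n)) {d z : Fin n → ℝ}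
    (hd : ∀ i ∉ S, d i = 0) (hz : lpNormVec 2 z ≤ ε * lpNormVec 1 z)
    (hS : S.card * ε ^ 2 ≤ 1 / 2) :
    lpNormVec 1 d ≤ 7 * lpNormVec 1 (d - z) := by
  -- Cauchy–Schwarz gives the factor `√(1/2)`, rounded up to `3/4`. With two triangle inequalities,
  -- `‖d‖ ≤ ‖d - z‖ + (3/4) (‖d‖ + ‖d - z‖)`, whence the `7`.
  have h1 : ∑ i ∈ S, |z i| ≤ 3 / 4 * lpNormVec 1 z := by
    have hcs : (∑ i ∈ S, |z i|) ^ 2 ≤ S.card * ∑ i ∈ S, |z i| ^ 2 := sq_sum_le_card_mul_sum_sq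
    have h2 : ∑ i ∈ S, |z i| ^ 2 ≤ lpNormVec 2 z ^ 2 := by
      rw [lpNormVec_two_eq, Real.sq_sqrt (Finset.sum_nonneg fun i _ => sq_nonneg _)]
      simp_rw [sq_abs]
      exact Finset.sum_le_univ_sum_of_nonneg fun i => sq_nonneg _
    have h20 : 0 ≤ lpNormVec 2 z := by rw [lpNormVec_two_eq]; positivity
    have h10 : 0 ≤ lpNormVec 1 z := by rw [lpNormVec_one_eq]; positivity
    refine abs_le_of_sq_le_sq' ?_ (by positivity) |>.2
    calc _ ≤ S.card * ∑ i ∈ S, |z i| ^ 2 := hcs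
      _ ≤ S.card * (ε * lpNormVec 1 z) ^ 2 := by gcongr; exact h2.trans (by gcongr)
      _ = (S.card * ε ^ 2) * lpNormVec 1 z ^ 2 := by ring
      _ ≤ (9 / 16) * lpNormVec 1 z ^ 2 := by gcongr; linarith
      _ = _ := by ring
  have h2 : lpNormVec 1 d ≤ lpNormVec 1 (d - z) + ∑ i ∈ S, |z i| := by
    have e : lpNormVec 1 d = ∑ i ∈ S, |d i| := by
      rw [lpNormVec_one_eq]
      refine (Finset.sum_subset (Finset.subset_univ S) fun i _ hi => ?_).symm
      rw [hd i hi, abs_zero]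
    have e' : ∑ i ∈ S, |(d - z) i| ≤ lpNormVec 1 (d - z) := by
      rw [lpNormVec_one_eq]
      exact Finset.sum_le_univ_sum_of_nonneg fun i => abs_nonneg _
    have e'' : ∑ i ∈ S, |d i| ≤ ∑ i ∈ S, (|(d - z) i| + |z i|) := by
      refine Finset.sum_le_sum fun i _ => ?_
      simpa using abs_add_le (d i - z i) (z i)
    rw [Finset.sum_add_distrib] at e''
    linarith
  have h3 : lpNormVec 1 z ≤ lpNormVec 1 d + lpNormVec 1 (d - z) := by
    simpa using lpNormVec_sub_le 1 d (d - z)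
  linarith

/-- Packing bound: a code of length `s` gives a separated set in the quotient of `ℓ₁ⁿ` by the kernel
of a sketch with `m` rows, so it has at most `29 ^ m` elements. -/
theorem card_code_le {m n s q : ℕ} (A : Matrix (Fin m) (Fin n) ℝ) {ε : ℝ}
    (hA : ∀ z : Fin n → ℝ, A *ᵥ z = 0 → lpNormVec 2 z ≤ ε * lpNormVec 1 z)
    (hs : 0 < s) (hsε : 4 * (s * ε ^ 2) ≤ 1) (φ : Fin s × Fin q ↪ Fin n)
    (T : Finset (Fin s → Fin q))
    (hT : ∀ f ∈ T, ∀ g ∈ T, f ≠ g → s ≤ 2 * hammingDist f g) :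
    (T.card : ℝ) ≤ 29 ^ m := by
  classical
  let E := PiLp 1 (fun _ : Fin n => ℝ)
  let B : E →ₗ[ℝ] (Fin m → ℝ) := A.mulVecLin ∘ₗ (WithLp.linearEquiv 1 ℝ (Fin n → ℝ)).toLinearMap
  let K : Submodule ℝ E := LinearMap.ker B
  have : IsClosed (K : Set E) := K.closed_of_finiteDimensional
  let supp : (Fin s → Fin q) → Finset (Fin n) := fun f => Finset.univ.image fun i => φ (i, f i)
  let x : (Fin s → Fin q) → Fin n → ℝ := fun f j => if j ∈ supp f then 1 else 0
  let c : (Fin s → Fin q) → E ⧸ K := fun f => Submodule.Quotient.mk (WithLp.toLp 1 (x f))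
  have hsupp : ∀ f, (supp f).card ≤ s := fun f => Finset.card_image_le.trans (by simp)
  have hs' : (0 : ℝ) < s := by exact_mod_cast hs
  have hnorm : ∀ f, ‖c f‖ ≤ s := by
    intro f
    refine (Submodule.Quotient.norm_mk_le _ _).trans ?_
    change lpNormVec 1 (x f) ≤ s
    rw [lpNormVec_one_eq]
    calc _ = ((supp f).card : ℝ) := by simp [x, apply_ite abs]
      _ ≤ s := by exact_mod_cast hsupp f
  have hdist : ∀ f g, s ≤ 2 * hammingDist f g → (s : ℝ) / 2 ≤ lpNormVec 1 (x f - x g) := by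
    intro f g hfg
    have hinj : Set.InjOn (fun i => φ (i, f i)) (Finset.univ.filter fun i => f i ≠ g i) := by
      intro i _ j _ hij
      exact (Prod.ext_iff.1 (φ.injective hij)).1
    have h1 : (hammingDist f g : ℝ) ≤ lpNormVec 1 (x f - x g) := by
      rw [lpNormVec_one_eq]
      calc (hammingDist f g : ℝ)
          = ∑ j ∈ (Finset.univ.filter fun i => f i ≠ g i).image (fun i => φ (i, f i)), (1 : ℝ) := by
            rw [Finset.sum_image hinj]; simp [hammingDist]
        _ ≤ ∑ j ∈ (Finset.univ.filter fun i => f i ≠ g i).image (fun i => φ (i, f i)),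
              |(x f - x g) j| := by
            refine Finset.sum_le_sum fun j hj => ?_
            obtain ⟨i, hi, rfl⟩ := Finset.mem_image.1 hj
            have hi := (Finset.mem_filter.1 hi).2
            have m1 : φ (i, f i) ∈ supp f := Finset.mem_image.2 ⟨i, Finset.mem_univ _, rfl⟩
            have m2 : φ (i, f i) ∉ supp g := by
              intro hm
              obtain ⟨k, -, hk⟩ := Finset.mem_image.1 hm
              have := Prod.ext_iff.1 (φ.injective hk)
              simp only at this
              obtain ⟨rfl, h⟩ := this
              exact hi h.symm
            simp [x, m1, m2]
        _ ≤ _ := Finset.sum_le_univ_sum_of_nonneg fun j => abs_nonneg _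
    have h2 : (s : ℝ) ≤ 2 * hammingDist f g := by exact_mod_cast hfg
    linarith
  have hsep : ∀ f g, s ≤ 2 * hammingDist f g → (s : ℝ) / 14 ≤ ‖c f - c g‖ := by
    intro f g hfg
    -- The quotient norm is an infimum, so take a representative `w` within `η` of it; `x f - x g -
    -- w` then lies in the kernel.
    refine le_of_forall_pos_le_add fun η hη => ?_
    obtain ⟨w, hw, hwn⟩ := Submodule.Quotient.norm_mk_lt (c f - c g) hη
    refine le_trans ?_ hwn.le
    have hmem : WithLp.toLp 1 (x f) - WithLp.toLp 1 (x g) - w ∈ K := by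
      rw [← Submodule.Quotient.eq, hw]
      rfl
    set z : Fin n → ℝ := x f - x g - WithLp.ofLp w with hz
    have hAz : A *ᵥ z = 0 := hmem
    have hle := le_lpNormVec_one_sub (supp f ∪ supp g) (d := x f - x g) (z := z) (ε := ε)
      (by
        intro i hi
        rw [Finset.mem_union, not_or] at hi
        simp [x, hi.1, hi.2]) (hA z hAz) (by
        have : ((supp f ∪ supp g).card : ℝ) ≤ 2 * s := by
          have := (Finset.card_union_le (supp f) (supp g)).trans (add_le_add (hsupp f) (hsupp g))
          have : (supp f ∪ supp g).card ≤ 2 * s := by omega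
          exact_mod_cast this
        nlinarith [mul_le_mul_of_nonneg_right this (sq_nonneg ε)])
    have e : x f - x g - z = WithLp.ofLp w := by rw [hz]; abel
    rw [e] at hle
    change _ ≤ lpNormVec 1 (WithLp.ofLp w)
    linarith [hdist f g hfg]
  have hcinj : Set.InjOn c T := by
    intro f hf g hg hfg
    by_contra hne
    have := hsep f g (hT f hf g hg hne)
    rw [hfg, sub_self, norm_zero] at this
    linarith
  have hcard := card_le_of_norm_le_of_separated (T.image c) (R := s) (δ := s / 14)
    (by positivity) hs'.le
    (by
      intro a ha
      obtain ⟨f, -, rfl⟩ := Finset.mem_image.1 ha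
      exact hnorm f)
    (by
      intro a ha b hb hab
      obtain ⟨f, hf, rfl⟩ := Finset.mem_image.1 ha
      obtain ⟨g, hg, rfl⟩ := Finset.mem_image.1 hb
      exact hsep f g (hT f hf g hg fun h => hab (by rw [h])))
  rw [Finset.card_image_of_injOn hcinj] at hcard
  have hfr : Module.finrank ℝ (E ⧸ K) ≤ m := by
    rw [(B.quotKerEquivRange).finrank_eq]
    simpa using Submodule.finrank_le (LinearMap.range B)
  have e : ((s : ℝ) + s / 14 / 2) / (s / 14 / 2) = 29 := by field_simp; norm_num
  rw [e] at hcard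
  exact hcard.trans (pow_le_pow_right₀ (by norm_num) hfr)

/-- The code has `s = ⌊1 / (4 ε²)⌋` blocks of `q = ⌊n / s⌋` coordinates. Logarithms of the packing
bound give `(s / 4) log N ≤ 4 m`; since `1 / ε² = 4 u ≤ 8 s`, the constant is `1 / 128`. -/
theorem rows_ge_of_kernel_bound {m n : ℕ} (A : Matrix (Fin m) (Fin n) ℝ) {ε : ℝ} (hε : 0 < ε)
    (hε2 : ε < 1 / 2) (hn : 1 / ε ^ 2 < (n : ℝ) / 2)
    (hA : ∀ z : Fin n → ℝ, A *ᵥ z = 0 → lpNormVec 2 z ≤ ε * lpNormVec 1 z) :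
    1 / 128 * (1 / ε ^ 2 * Real.log (ε ^ 2 * n)) ≤ m := by
  have hε0 : 0 < ε ^ 2 := by positivity
  set N : ℝ := ε ^ 2 * n with hN
  have hN2 : 2 < N := by
    rw [div_lt_iff₀ hε0] at hn
    rw [hN]; linarith
  set u : ℝ := 1 / (4 * ε ^ 2) with hu
  have hu1 : 1 < u := by
    rw [hu, lt_div_iff₀ (by positivity)]
    nlinarith
  set s : ℕ := ⌊u⌋₊ with hsdef
  have hs1 : 1 ≤ s := Nat.le_floor (by simpa using hu1.le)
  have hsu : (s : ℝ) ≤ u := Nat.floor_le (by linarith)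
  have hus : u ≤ 2 * s := by
    have h1 := Nat.lt_floor_add_one u
    have h2 : (1 : ℝ) ≤ s := by exact_mod_cast hs1
    linarith
  have hs' : (0 : ℝ) < s := by exact_mod_cast hs1
  have hsε : 4 * (s * ε ^ 2) ≤ 1 := by
    rw [hu, le_div_iff₀ (by positivity)] at hsu
    linarith
  set q : ℕ := n / s with hqdef
  have hq : 4 * N - 1 ≤ q := by
    have h1 : (n : ℝ) < s * (q + 1) := by exact_mod_cast Nat.lt_mul_div_succ n hs1
    have h2 : 4 * N * s ≤ n := by
      have : (0 : ℝ) ≤ n := by positivity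
      rw [hN]; nlinarith
    have : 4 * N * s < (q + 1) * s := by linarith
    linarith [lt_of_mul_lt_mul_right this hs'.le]
  have hq0 : 0 < q := by
    have : (0 : ℝ) < q := by linarith
    exact_mod_cast this
  have hφ : Fintype.card (Fin s × Fin q) ≤ Fintype.card (Fin n) := by
    simpa using Nat.mul_div_le n s
  obtain ⟨φ⟩ := Function.Embedding.nonempty_of_card_le hφ
  obtain ⟨T, hT, hTc⟩ := exists_code s q hq0
  have hle := hTc.trans (card_code_le A hA hs1 hsε φ T hT)
  -- This uses `q ≥ 4 N - 1` and `N > 2`. It keeps `log (√q / 2) = log (q / 4) / 2` comparable to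
  -- `log N` even when `N` is close to `2`.
  have hsqN : √N ≤ q / 4 := by
    have h1 : √N ^ 2 = N := Real.sq_sqrt (by linarith)
    have h2 : (1.4 : ℝ) ≤ √N := Real.le_sqrt_of_sq_le (by norm_num; linarith)
    nlinarith
  have hlog : 1 / 4 * Real.log N ≤ Real.log (√q / 2) := by
    have h1 : √(q : ℝ) / 2 = √(q / 4) := by
      rw [Real.sqrt_div (by positivity), show (4 : ℝ) = 2 ^ 2 by norm_num,
        Real.sqrt_sq (by norm_num)]
    have h2 : Real.log √N ≤ Real.log (q / 4) :=
      Real.log_le_log (Real.sqrt_pos.2 (by linarith)) hsqN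
    rw [h1, Real.log_sqrt (by positivity)]
    rw [Real.log_sqrt (by linarith)] at h2
    linarith
  have hq1 : (0 : ℝ) < √q / 2 := by
    have : (0 : ℝ) < q := by exact_mod_cast hq0
    positivity
  have h := Real.log_le_log (by positivity) hle
  rw [Real.log_pow, Real.log_pow] at h
  have h29 : Real.log 29 ≤ 4 := by
    rw [Real.log_le_iff_le_exp (by norm_num)]
    have : Real.exp 4 = Real.exp 1 ^ 4 := by rw [← Real.exp_nat_mul]; norm_num
    rw [this]
    calc (29 : ℝ) ≤ 2.7 ^ 4 := by norm_num
      _ ≤ _ := by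
        gcongr
        linarith [Real.exp_one_gt_d9]
  have hlogN : 0 ≤ Real.log N := Real.log_nonneg (by linarith)
  have hm : (m : ℝ) * Real.log 29 ≤ m * 4 := by gcongr
  have h5 : 1 / ε ^ 2 = 4 * u := by rw [hu]; field_simp
  have h6 : (s : ℝ) * (1 / 4 * Real.log N) ≤ s * Real.log (√q / 2) := by gcongr
  have h7 : u * Real.log N ≤ 2 * s * Real.log N := by gcongr
  rw [h5]
  nlinarith

/-! ### Upper bound: from integer vectors to the kernel -/

/-- A vector with entries in `[-1, 1]` and `ℓ₁` norm at most `L` is dominated, in the direction `g`,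
by a vector with entries in `{-1, 0, 1}` and at most `L` nonzero entries. -/
theorem exists_sign_vector {n : ℕ} (L : ℕ) (f g : Fin n → ℝ) (hf : ∀ i, |f i| ≤ 1)
    (hfL : ∑ i, |f i| ≤ L) :
    ∃ e : Fin n → ℤ, (∀ i, |e i| ≤ 1) ∧ ∑ i, |e i| ≤ L ∧ ∑ i, g i * f i ≤ ∑ i, g i * e i := by
  classical
  -- Take `S` to be the `L` coordinates where `|g|` is largest, and let `e` be the sign of `g` on
  -- `S`.
  suffices h : ∃ S : Finset (Fin n), S.card ≤ L ∧ ∑ i, |g i| * |f i| ≤ ∑ i ∈ S, |g i| by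
    obtain ⟨S, hS, hgS⟩ := h
    have hle : ∀ i, |if i ∈ S then (SignType.sign (g i) : ℤ) else 0| ≤ if i ∈ S then 1 else 0 := by
      intro i
      split_ifs
      · cases SignType.sign (g i) <;> simp
      · simp
    refine ⟨fun i => if i ∈ S then (SignType.sign (g i) : ℤ) else 0, fun i => ?_, ?_, ?_⟩
    · exact (hle i).trans (by split_ifs <;> simp)
    · refine (Finset.sum_le_sum fun i _ => hle i).trans ?_
      simpa using hS
    · calc _ ≤ ∑ i, |g i| * |f i| :=
            Finset.sum_le_sum fun i _ => (le_abs_self _).trans (abs_mul _ _).le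
        _ ≤ _ := hgS
        _ = _ := by
          simp [apply_ite (Int.cast : ℤ → ℝ), self_mul_sign]
  rcases le_or_gt n L with hn | hn
  · exact ⟨Finset.univ, by simpa using hn, Finset.sum_le_sum fun i _ =>
      mul_le_of_le_one_right (abs_nonneg _) (hf i)⟩
  · obtain ⟨S, hS, hmax⟩ := Finset.exists_max_image (Finset.univ.powersetCard L)
      (fun S : Finset (Fin n) => ∑ i ∈ S, |g i|)
      (Finset.powersetCard_nonempty.2 (by simpa using hn.le))
    have hSc : S.card = L := (Finset.mem_powersetCard.1 hS).2
    refine ⟨S, hSc.le, ?_⟩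
    have hswap : ∀ i ∈ S, ∀ j ∉ S, |g j| ≤ |g i| := by
      intro i hi j hj
      have hj' : j ∉ S.erase i := fun h => hj (Finset.mem_of_mem_erase h)
      have h := hmax (insert j (S.erase i)) (Finset.mem_powersetCard.2 ⟨Finset.subset_univ _, by
        rw [Finset.card_insert_of_notMem hj', Finset.card_erase_of_mem hi, hSc]
        have : 0 < S.card := Finset.card_pos.2 ⟨i, hi⟩
        omega⟩)
      rw [Finset.sum_insert hj', ← Finset.add_sum_erase S _ hi] at h
      linarith
    -- A threshold separating `|g|` on `S` from `|g|` off `S`. Raising `|f|` to `1` on `S` gains at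
    -- least `t` per unit, dropping `f` off `S` loses at most `t` per unit, and the budget `L` makes
    -- the gain cover the loss.
    obtain ⟨t, ht, htS, htc⟩ : ∃ t : ℝ, 0 ≤ t ∧ (∀ i ∈ S, t ≤ |g i|) ∧ ∀ j ∉ S, |g j| ≤ t := by
      obtain ⟨j, hjS, hj⟩ : ∃ j ∈ Sᶜ, ∀ k ∈ Sᶜ, |g k| ≤ |g j| :=
        Finset.exists_max_image Sᶜ (fun j => |g j|) (by
          rw [← Finset.card_pos, Finset.card_compl, hSc, Fintype.card_fin]; omega)
      exact ⟨|g j|, abs_nonneg _, fun i hi => hswap i hi j (Finset.mem_compl.1 hjS),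
        fun k hk => hj k (Finset.mem_compl.2 hk)⟩
    have h1 : ∑ i ∈ S, |g i| * |f i| + ∑ i ∈ S, t * (1 - |f i|) ≤ ∑ i ∈ S, |g i| := by
      rw [← Finset.sum_add_distrib]
      refine Finset.sum_le_sum fun i hi => ?_
      nlinarith [htS i hi, hf i]
    have h2 : ∑ i ∈ Sᶜ, |g i| * |f i| ≤ ∑ i ∈ Sᶜ, t * |f i| :=
      Finset.sum_le_sum fun i hi => by
        have := htc i (Finset.mem_compl.1 hi)
        gcongr
    have h3 : ∑ i ∈ S, |f i| + ∑ i ∈ Sᶜ, |f i| ≤ L := by rwa [Finset.sum_add_sum_compl]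
    rw [← Finset.mul_sum] at h1 h2
    rw [Finset.sum_sub_distrib] at h1
    rw [← Finset.sum_add_sum_compl S]
    simp only [Finset.sum_const, hSc, nsmul_eq_mul, mul_one] at h1
    nlinarith

/-- A matrix that distorts the norms of all integer vectors with `ℓ₁` norm at most `L` by a bounded
factor only (as a map from `ℓ₂` to `ℓ₁`) has no kernel vectors with a large `ℓ₂` norm. -/
theorem lpNormVec_two_le_of_mulVec_eq_zero {m n L : ℕ} (A : Matrix (Fin m) (Fin n) ℝ) {a b : ℝ}
    (ha : 0 < a) (hb : 0 ≤ b)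
    (hA : ∀ k : Fin n → ℤ, ∑ i, |k i| ≤ L →
      a * lpNormVec 2 (fun i => (k i : ℝ)) ≤ lpNormVec 1 (A *ᵥ fun i => (k i : ℝ)) ∧
        lpNormVec 1 (A *ᵥ fun i => (k i : ℝ)) ≤ b * lpNormVec 2 (fun i => (k i : ℝ)))
    (w : Fin n → ℝ) (hw : lpNormVec 1 w ≤ L) (hAw : A *ᵥ w = 0) :
    lpNormVec 2 w ≤ (1 + b / a) * √L := by
  -- Rounding towards zero: neither the integer part nor the remainder exceeds `x` in absolute
  -- value, so both inherit the `ℓ₁` bound `L`.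
  have htr : ∀ x : ℝ, ∃ k : ℤ, |(k : ℝ)| ≤ |x| ∧ |x - k| ≤ 1 ∧ |x - k| ≤ |x| := by
    intro x
    rcases le_total 0 x with h | h
    · have h0 : (0 : ℝ) ≤ ⌊x⌋ := by exact_mod_cast Int.floor_nonneg.2 h
      have h1 := Int.floor_le x
      have h2 := Int.lt_floor_add_one x
      refine ⟨⌊x⌋, ?_, ?_, ?_⟩
      · rwa [abs_of_nonneg h0, abs_of_nonneg h]
      · rw [abs_of_nonneg (by linarith)]; linarith
      · rw [abs_of_nonneg (by linarith), abs_of_nonneg h]; linarith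
    · have h0 : (⌈x⌉ : ℝ) ≤ 0 := by exact_mod_cast Int.ceil_nonpos.2 h
      have h1 := Int.le_ceil x
      have h2 := Int.ceil_lt_add_one x
      refine ⟨⌈x⌉, ?_, ?_, ?_⟩
      · rw [abs_of_nonpos h0, abs_of_nonpos h]; linarith
      · rw [abs_of_nonpos (by linarith)]; linarith
      · rw [abs_of_nonpos (by linarith), abs_of_nonpos h]; linarith
  choose k hk using fun i => htr (w i)
  rw [lpNormVec_one_eq] at hw
  set f : Fin n → ℝ := w - fun i => (k i : ℝ) with hf
  have hwf : w = (fun i => (k i : ℝ)) + f := by rw [hf]; abel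
  have hf1 : ∀ i, |f i| ≤ 1 := fun i => (hk i).2.1
  have hfL : ∑ i, |f i| ≤ L := (Finset.sum_le_sum fun i _ => (hk i).2.2).trans hw
  have hkL : ∑ i, |k i| ≤ L := by
    have : ((∑ i, |k i| : ℤ) : ℝ) ≤ L := by
      push_cast
      exact (Finset.sum_le_sum fun i _ => (hk i).1).trans hw
    exact_mod_cast this
  have hf2 : lpNormVec 2 f ≤ √L := by
    rw [lpNormVec_two_eq]
    refine Real.sqrt_le_sqrt (le_trans (Finset.sum_le_sum fun i _ => ?_) hfL)
    rw [← sq_abs]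
    nlinarith [hf1 i, abs_nonneg (f i)]
  have hAf : lpNormVec 1 (A *ᵥ f) ≤ b * √L := by
    -- Duality: `‖A f‖₁` is the value at `f` of the linear functional `v ᵥ* A`, so `f` can be
    -- replaced by a sparse sign vector, to which `hA` applies.
    set v : Fin m → ℝ := fun j => (SignType.sign ((A *ᵥ f) j) : ℝ) with hv
    have h1 : lpNormVec 1 (A *ᵥ f) = ∑ i, (v ᵥ* A) i * f i := by
      change _ = (v ᵥ* A) ⬝ᵥ f
      rw [← Matrix.dotProduct_mulVec, lpNormVec_one_eq]
      refine Finset.sum_congr rfl fun j _ => ?_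
      simp [hv]
    obtain ⟨e, he1, heL, hef⟩ := exists_sign_vector L f (v ᵥ* A) hf1 hfL
    have h2 : ∑ i, (v ᵥ* A) i * (e i : ℝ) ≤ lpNormVec 1 (A *ᵥ fun i => (e i : ℝ)) := by
      change (v ᵥ* A) ⬝ᵥ (fun i => (e i : ℝ)) ≤ _
      rw [← Matrix.dotProduct_mulVec, lpNormVec_one_eq]
      refine Finset.sum_le_sum fun j _ => (le_abs_self _).trans ?_
      rw [abs_mul]
      refine mul_le_of_le_one_left (abs_nonneg _) ?_
      simp only [hv]
      cases SignType.sign ((A *ᵥ f) j) <;> simp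
    have h3 : lpNormVec 2 (fun i => (e i : ℝ)) ≤ √L := by
      rw [lpNormVec_two_eq]
      refine Real.sqrt_le_sqrt ?_
      have : ∑ i, e i ^ 2 ≤ (L : ℤ) := le_trans (Finset.sum_le_sum fun i _ => by
        rw [← sq_abs]
        nlinarith [he1 i, abs_nonneg (e i)]) heL
      exact_mod_cast this
    rw [h1]
    exact hef.trans (h2.trans ((hA e heL).2.trans (by gcongr)))
  have hAk : lpNormVec 1 (A *ᵥ fun i => (k i : ℝ)) = lpNormVec 1 (A *ᵥ f) := by
    have : A *ᵥ (fun i => (k i : ℝ)) = (-1 : ℝ) • (A *ᵥ f) := by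
      rw [hwf, Matrix.mulVec_add] at hAw
      rw [neg_one_smul]
      exact eq_neg_of_add_eq_zero_left hAw
    rw [this, lpNormVec_smul]
    simp
  have h4 : lpNormVec 2 (fun i => (k i : ℝ)) ≤ b / a * √L := by
    have := (hA k hkL).1
    rw [div_mul_eq_mul_div, le_div_iff₀ ha]
    linarith
  have h5 := lpNormVec_add_le 2 (fun i => (k i : ℝ)) f
  rw [← hwf] at h5
  linarith

/-! ### Counting integer points of an `ℓ₁` ball -/

/-- The subtracted term lets the induction close: for `t ≤ 1/2`, the two new terms `2 t ^ (L + 1)`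
are at most `4 t ^ (L + 1) - 4 t ^ (L + 2)`. -/
theorem sum_Icc_pow_natAbs_le {t : ℝ} (ht0 : 0 ≤ t) (ht1 : t ≤ 1 / 2) (L : ℕ) :
    ∑ j ∈ Finset.Icc (-L : ℤ) L, t ^ j.natAbs ≤ 1 + 4 * t - 4 * t ^ (L + 1) := by
  induction L with
  | zero => simp
  | succ L ih =>
    have e : Finset.Icc (-((L + 1 : ℕ) : ℤ)) ((L + 1 : ℕ) : ℤ) =
        insert ((L + 1 : ℕ) : ℤ) (insert (-((L + 1 : ℕ) : ℤ)) (Finset.Icc (-L : ℤ) L)) := by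
      ext j
      simp only [Finset.mem_Icc, Finset.mem_insert]
      omega
    rw [e, Finset.sum_insert (by simp only [Finset.mem_Icc, Finset.mem_insert]; omega),
      Finset.sum_insert (by simp only [Finset.mem_Icc]; omega), Int.natAbs_neg, Int.natAbs_natCast,
      pow_succ t (L + 1)]
    have : 0 ≤ t ^ (L + 1) := by positivity
    nlinarith

/-- Number of integer vectors with `ℓ₁` norm at most `L`. -/
theorem exists_finset_int_vectors {n L : ℕ} (hL : 0 < L) (hn : 2 * L ≤ n) :
    ∃ V : Finset (Fin n → ℤ), (∀ k, ∑ i, |k i| ≤ (L : ℤ) → k ∈ V) ∧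
      (V.card : ℝ) ≤ Real.exp (L * (4 + Real.log (n / L))) := by
  classical
  have hL' : (0 : ℝ) < L := by exact_mod_cast hL
  have hn' : 2 * (L : ℝ) ≤ n := by exact_mod_cast hn
  have hn0 : (0 : ℝ) < n := by linarith
  set I : Finset ℤ := Finset.Icc (-L : ℤ) L with hI
  -- Generating function argument: the weight `t ^ (‖k‖₁ - L)` is at least `1` on every counted
  -- vector, and its sum over a box factorises into at most `(1 / t) ^ L * (1 + 4 t) ^ n`. This `t`
  -- makes the second factor `exp (O(L))`.
  set t : ℝ := L / n with ht
  have ht0 : 0 < t := by positivity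
  have ht1 : t ≤ 1 / 2 := by rw [ht, div_le_iff₀ hn0]; linarith
  refine ⟨(Fintype.piFinset fun _ : Fin n => I).filter fun k => ∑ i, |k i| ≤ (L : ℤ), ?_, ?_⟩
  · intro k hk
    refine Finset.mem_filter.2 ⟨Fintype.mem_piFinset.2 fun i => ?_, hk⟩
    have := (Finset.single_le_sum (f := fun i => |k i|) (fun i _ => abs_nonneg _)
      (Finset.mem_univ i)).trans hk
    rw [hI, Finset.mem_Icc]
    exact abs_le.1 this
  · have hone : ∑ j ∈ I, t ^ j.natAbs ≤ 1 + 4 * t :=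
      (sum_Icc_pow_natAbs_le ht0.le ht1 L).trans (by
        have : 0 ≤ t ^ (L + 1) := by positivity
        linarith)
    calc _ = ∑ k ∈ (Fintype.piFinset fun _ : Fin n => I).filter (fun k => ∑ i, |k i| ≤ (L : ℤ)), (1 : ℝ) := by
          simp
      _ ≤ ∑ k ∈ (Fintype.piFinset fun _ : Fin n => I).filter (fun k => ∑ i, |k i| ≤ (L : ℤ)),
            (1 / t) ^ L * ∏ i, t ^ (k i).natAbs := by
          refine Finset.sum_le_sum fun k hk => ?_
          have hk := (Finset.mem_filter.1 hk).2
          have hk' : ∑ i, (k i).natAbs ≤ L := by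
            zify; exact hk
          rw [Finset.prod_pow_eq_pow_sum]
          have h1 : t ^ L ≤ t ^ ∑ i, (k i).natAbs :=
            pow_le_pow_of_le_one ht0.le (by linarith) hk'
          calc (1 : ℝ) = (1 / t) ^ L * t ^ L := by
                rw [← mul_pow, one_div_mul_cancel ht0.ne', one_pow]
            _ ≤ _ := by gcongr
      _ ≤ ∑ k ∈ Fintype.piFinset fun _ : Fin n => I, (1 / t) ^ L * ∏ i, t ^ (k i).natAbs :=
          Finset.sum_le_sum_of_subset_of_nonneg (Finset.filter_subset _ _)
            fun _ _ _ => by positivity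
      _ = (1 / t) ^ L * (∑ j ∈ I, t ^ j.natAbs) ^ n := by
          rw [← Finset.mul_sum, ← Finset.prod_univ_sum (fun _ : Fin n => I)
            (fun _ j => t ^ j.natAbs)]
          simp
      _ ≤ (1 / t) ^ L * Real.exp (4 * t) ^ n := by
          gcongr
          linarith [Real.add_one_le_exp (4 * t)]
      _ = _ := by
          rw [← Real.exp_nat_mul]
          have h1 : (n : ℝ) * (4 * t) = L * 4 := by rw [ht]; field_simp
          have h2 : 1 / t = Real.exp (Real.log (n / L)) := by
            rw [Real.exp_log (by positivity), ht, one_div_div]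
          rw [h1, h2, ← Real.exp_nat_mul, ← Real.exp_add]
          congr 1
          ring

/-! ### Moments of random signed sums -/

/-- The sign `±1` encoded by a Boolean. -/
def boolSign (b : Bool) : ℝ := if b then 1 else -1

/-- The sum of the entries of `x` with the signs encoded by `r`. -/
def signSum {n : ℕ} (x : Fin n → ℝ) (r : Fin n → Bool) : ℝ := ∑ i, boolSign (r i) * x i

theorem sum_bool_fun_succ {n : ℕ} (F : (Fin (n + 1) → Bool) → ℝ) :
    ∑ r, F r = ∑ r : Fin n → Bool, (F (Fin.cons true r) + F (Fin.cons false r)) := by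
  rw [← (Fin.consEquiv fun _ => Bool).sum_comp, Fintype.sum_prod_type, Fintype.sum_bool,
    ← Finset.sum_add_distrib]
  rfl

theorem signSum_cons {n : ℕ} (x : Fin (n + 1) → ℝ) (b : Bool) (r : Fin n → Bool) :
    signSum x (Fin.cons b r) = boolSign b * x 0 + signSum (fun i => x i.succ) r := by
  simp [signSum, Fin.sum_univ_succ]

theorem sum_signSum_sq {n : ℕ} (x : Fin n → ℝ) :
    ∑ r, signSum x r ^ 2 = 2 ^ n * ∑ i, x i ^ 2 := by
  induction n with
  | zero => simp [signSum]
  | succ n ih =>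
    rw [sum_bool_fun_succ, Fin.sum_univ_succ]
    simp only [signSum_cons, boolSign]
    calc _ = ∑ r, (2 * x 0 ^ 2 + 2 * signSum (fun i => x i.succ) r ^ 2) :=
          Finset.sum_congr rfl fun r _ => by simp; ring
      _ = _ := by
        simp only [Finset.sum_add_distrib, ← Finset.mul_sum, ih]
        simp
        ring

/-- Averaging over the first sign kills the odd powers, which leaves an induction using the second
moment. -/
theorem sum_signSum_pow_four_le {n : ℕ} (x : Fin n → ℝ) :
    ∑ r, signSum x r ^ 4 ≤ 2 ^ n * (3 * (∑ i, x i ^ 2) ^ 2) := by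
  induction n with
  | zero => simp [signSum]
  | succ n ih =>
    rw [sum_bool_fun_succ, Fin.sum_univ_succ]
    simp only [signSum_cons, boolSign]
    have ih := ih fun i => x i.succ
    have h2 := sum_signSum_sq fun i => x i.succ
    set T := ∑ i : Fin n, x i.succ ^ 2
    calc _ = ∑ r, (2 * x 0 ^ 4 + 12 * x 0 ^ 2 * signSum (fun i => x i.succ) r ^ 2
            + 2 * signSum (fun i => x i.succ) r ^ 4) :=
          Finset.sum_congr rfl fun r _ => by simp; ring
      _ = 2 ^ n * (2 * x 0 ^ 4) + 12 * x 0 ^ 2 * (2 ^ n * T)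
            + 2 * ∑ r, signSum (fun i => x i.succ) r ^ 4 := by
        simp only [Finset.sum_add_distrib, ← Finset.mul_sum, h2]
        simp
        ring
      _ ≤ 2 ^ n * (2 * x 0 ^ 4) + 12 * x 0 ^ 2 * (2 ^ n * T) + 2 * (2 ^ n * (3 * T ^ 2)) := by
        gcongr
      _ ≤ _ := by
        rw [pow_succ 2 n]
        have : (0 : ℝ) ≤ 2 ^ n * x 0 ^ 4 := by positivity
        linarith

/-- Independent signs give a product of hyperbolic cosines, and `cosh a ≤ exp (a² / 2)`. -/
theorem sum_exp_signSum_le {n : ℕ} (x : Fin n → ℝ) :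
    ∑ r, Real.exp (signSum x r) ≤ 2 ^ n * Real.exp ((∑ i, x i ^ 2) / 2) := by
  induction n with
  | zero => simp [signSum]
  | succ n ih =>
    rw [sum_bool_fun_succ, Fin.sum_univ_succ]
    simp only [signSum_cons, boolSign]
    calc _ = ∑ r, 2 * Real.cosh (x 0) * Real.exp (signSum (fun i => x i.succ) r) := by
          refine Finset.sum_congr rfl fun r _ => ?_
          simp [Real.exp_add, Real.cosh_eq]
          ring
      _ = 2 * Real.cosh (x 0) * ∑ r, Real.exp (signSum (fun i => x i.succ) r) := by
        rw [Finset.mul_sum]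
      _ ≤ 2 * Real.exp (x 0 ^ 2 / 2) *
            (2 ^ n * Real.exp ((∑ i : Fin n, x i.succ ^ 2) / 2)) := by
        gcongr
        · exact Real.cosh_le_exp_half_sq _
        · exact ih _
      _ = _ := by
        rw [add_div, Real.exp_add]
        ring

theorem sum_exp_abs_signSum_le {n : ℕ} (x : Fin n → ℝ) (hx : ∑ i, x i ^ 2 = 1) :
    ∑ r, Real.exp |signSum x r| ≤ 2 ^ n * (2 * Real.exp (1 / 2)) := by
  have h1 := sum_exp_signSum_le x
  have h2 := sum_exp_signSum_le (-x)
  simp only [Pi.neg_apply, neg_sq, hx] at h1 h2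
  calc _ ≤ ∑ r, (Real.exp (signSum x r) + Real.exp (signSum (-x) r)) := by
        refine Finset.sum_le_sum fun r _ => ?_
        have e : signSum (-x) r = -signSum x r := by simp [signSum]
        rw [e]
        rcases abs_choice (signSum x r) with h | h <;> rw [h]
        · linarith [Real.exp_pos (-signSum x r)]
        · linarith [Real.exp_pos (signSum x r)]
    _ ≤ _ := by
      rw [Finset.sum_add_distrib]
      linarith

/-- Turns the second and fourth moments into a bound on the Laplace transform of `|y|`: for unit
vectors the average is at most `1 - 1/2 + 3/8 = 7/8`. -/
theorem exp_neg_abs_le (y : ℝ) : Real.exp (-|y|) ≤ 1 - y ^ 2 / 2 + y ^ 4 / 8 := by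
  have h0 := abs_nonneg y
  have e2 : y ^ 2 = |y| ^ 2 := (sq_abs y).symm
  have e4 : y ^ 4 = |y| ^ 4 := by rw [show (4 : ℕ) = 2 * 2 from rfl, pow_mul, pow_mul, e2]
  rw [e2, e4, Real.exp_neg]
  set u := |y|
  refine (inv_anti₀ (by linarith) (Real.add_one_le_exp u)).trans ?_
  rw [inv_le_iff_one_le_mul₀ (by linarith)]
  -- From `exp (-u) ≤ 1 / (1 + u)`, what remains after clearing the denominator is `u` times this
  -- quartic.
  have h : 0 ≤ 1 - u / 2 - u ^ 2 / 2 + u ^ 3 / 8 + u ^ 4 / 8 := by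
    nlinarith [sq_nonneg (u ^ 2 + u / 2 - 5 / 2), sq_nonneg (u - 1.35), sq_nonneg (u ^ 2 - 1.8)]
  nlinarith [mul_nonneg h0 h]

theorem sum_exp_neg_abs_signSum_le {n : ℕ} (x : Fin n → ℝ) (hx : ∑ i, x i ^ 2 = 1) :
    ∑ r, Real.exp (-|signSum x r|) ≤ 2 ^ n * (7 / 8) := by
  have h2 := sum_signSum_sq x
  have h4 := sum_signSum_pow_four_le x
  rw [hx] at h2 h4
  calc _ ≤ ∑ r, (1 - signSum x r ^ 2 / 2 + signSum x r ^ 4 / 8) :=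
        Finset.sum_le_sum fun r _ => exp_neg_abs_le _
    _ = 2 ^ n - (∑ r, signSum x r ^ 2) / 2 + (∑ r, signSum x r ^ 4) / 8 := by
      rw [Finset.sum_add_distrib, Finset.sum_sub_distrib, Finset.sum_div, Finset.sum_div]
      simp
    _ ≤ _ := by rw [h2]; linarith

/-! ### Existence of a good sign matrix -/

/-- Averaging a product over independent rows. -/
theorem sum_prod_rows {m n : ℕ} (F : (Fin n → Bool) → ℝ) :
    ∑ ω : Fin m → Fin n → Bool, ∏ j, F (ω j) = (∑ r, F r) ^ m := by
  classical
  rw [← Fintype.piFinset_univ, ← Finset.prod_univ_sum (fun _ : Fin m => Finset.univ)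
    (fun _ r => F r)]
  simp

/-- Chernoff bounds for both tails, each row contributing a factor at most `15/16`: below, `exp
(1/16) * (7/8)`; above, `exp (-2) * 2 exp (1/2)`. If the average of the sum of all the exponentials
is below `1`, some choice of signs makes every exponent negative. -/
theorem exists_signs {m n : ℕ} (V : Finset (Fin n → ℝ)) (hV : ∀ x ∈ V, ∑ i, x i ^ 2 = 1)
    (hm : 2 * V.card * (15 / 16 : ℝ) ^ m < 1) :
    ∃ ω : Fin m → Fin n → Bool, ∀ x ∈ V,
      m / 16 ≤ ∑ j, |signSum x (ω j)| ∧ ∑ j, |signSum x (ω j)| ≤ 2 * m := by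
  classical
  have hlow : ∀ x ∈ V, ∑ ω : Fin m → Fin n → Bool,
      Real.exp (m / 16 - ∑ j, |signSum x (ω j)|) ≤ (2 ^ n) ^ m * (15 / 16) ^ m := by
    intro x hx
    have h16 : Real.exp (1 / 16) ≤ 15 / 14 := by
      have := Real.exp_bound_div_one_sub_of_interval (x := 1 / 16) (by norm_num) (by norm_num)
      norm_num at this ⊢
      linarith
    calc _ = ∑ ω : Fin m → Fin n → Bool, ∏ j,
            (Real.exp (1 / 16) * Real.exp (-|signSum x (ω j)|)) := by
          refine Finset.sum_congr rfl fun ω _ => ?_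
          simp_rw [← Real.exp_add]
          rw [← Real.exp_sum, Finset.sum_add_distrib, Finset.sum_neg_distrib]
          simp
          ring_nf
      _ = (Real.exp (1 / 16) * ∑ r, Real.exp (-|signSum x r|)) ^ m := by
          rw [sum_prod_rows (fun r => Real.exp (1 / 16) * Real.exp (-|signSum x r|)),
            Finset.mul_sum]
      _ ≤ (15 / 14 * (2 ^ n * (7 / 8))) ^ m := by
          gcongr
          exact sum_exp_neg_abs_signSum_le x (hV x hx)
      _ = _ := by rw [← mul_pow]; congr 1; ring
  have hup : ∀ x ∈ V, ∑ ω : Fin m → Fin n → Bool,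
      Real.exp (∑ j, |signSum x (ω j)| - 2 * m) ≤ (2 ^ n) ^ m * (15 / 16) ^ m := by
    intro x hx
    have h2 : Real.exp (-2) * (2 * Real.exp (1 / 2)) ≤ 15 / 16 := by
      have e : Real.exp (-2) * (2 * Real.exp (1 / 2)) = 2 * Real.exp (-(3 / 2)) := by
        rw [mul_left_comm, ← Real.exp_add]; norm_num
      rw [e, Real.exp_neg]
      have h : (5 / 2 : ℝ) ≤ Real.exp (3 / 2) := by
        linarith [Real.add_one_le_exp (3 / 2 : ℝ)]
      have := inv_anti₀ (by norm_num) h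
      norm_num at this ⊢
      linarith
    calc _ = ∑ ω : Fin m → Fin n → Bool, ∏ j,
            (Real.exp (-2) * Real.exp |signSum x (ω j)|) := by
          refine Finset.sum_congr rfl fun ω _ => ?_
          simp_rw [← Real.exp_add]
          rw [← Real.exp_sum, Finset.sum_add_distrib]
          simp
          ring_nf
      _ = (Real.exp (-2) * ∑ r, Real.exp |signSum x r|) ^ m := by
          rw [sum_prod_rows (fun r => Real.exp (-2) * Real.exp |signSum x r|), Finset.mul_sum]
      _ ≤ (2 ^ n * (15 / 16)) ^ m := by
          refine pow_le_pow_left₀ (by positivity) ?_ m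
          calc _ ≤ Real.exp (-2) * (2 ^ n * (2 * Real.exp (1 / 2))) := by
                gcongr
                exact sum_exp_abs_signSum_le x (hV x hx)
            _ = 2 ^ n * (Real.exp (-2) * (2 * Real.exp (1 / 2))) := by ring
            _ ≤ _ := by gcongr
      _ = _ := by rw [← mul_pow]
  obtain ⟨ω, -, hω⟩ : ∃ ω ∈ (Finset.univ : Finset (Fin m → Fin n → Bool)),
      ∑ x ∈ V, (Real.exp (m / 16 - ∑ j, |signSum x (ω j)|) +
        Real.exp (∑ j, |signSum x (ω j)| - 2 * m)) < 1 := by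
    refine Finset.exists_lt_of_sum_lt ?_
    rw [Finset.sum_comm]
    calc _ ≤ ∑ x ∈ V, ((2 ^ n) ^ m * (15 / 16 : ℝ) ^ m + (2 ^ n) ^ m * (15 / 16 : ℝ) ^ m) := by
          refine Finset.sum_le_sum fun x hx => ?_
          rw [Finset.sum_add_distrib]
          exact add_le_add (hlow x hx) (hup x hx)
      _ = (2 ^ n) ^ m * (2 * V.card * (15 / 16 : ℝ) ^ m) := by
          rw [Finset.sum_const, nsmul_eq_mul]
          ring
      _ < (2 ^ n) ^ m * 1 := by gcongr
      _ = _ := by simp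
  refine ⟨ω, fun x hx => ?_⟩
  have h := (Finset.single_le_sum (f := fun x => Real.exp (m / 16 - ∑ j, |signSum x (ω j)|) +
    Real.exp (∑ j, |signSum x (ω j)| - 2 * m)) (fun x _ => by positivity) hx).trans_lt hω
  have p1 := Real.exp_pos (m / 16 - ∑ j, |signSum x (ω j)|)
  have p2 := Real.exp_pos (∑ j, |signSum x (ω j)| - 2 * m)
  have h1 := Real.exp_lt_one_iff.1 (show Real.exp (m / 16 - ∑ j, |signSum x (ω j)|) < 1 by linarith)
  have h2 := Real.exp_lt_one_iff.1
    (show Real.exp (∑ j, |signSum x (ω j)| - 2 * m) < 1 by linarith)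
  constructor <;> linarith

theorem exists_matrix_int_vectors {m n L : ℕ} (hL : 0 < L) (hn : 2 * L ≤ n)
    (hm : 2 * Real.exp (L * (4 + Real.log (n / L))) * (15 / 16 : ℝ) ^ m < 1) :
    ∃ A : Matrix (Fin m) (Fin n) ℝ, ∀ k : Fin n → ℤ, ∑ i, |k i| ≤ L →
      m / 16 * lpNormVec 2 (fun i => (k i : ℝ)) ≤ lpNormVec 1 (A *ᵥ fun i => (k i : ℝ)) ∧
        lpNormVec 1 (A *ᵥ fun i => (k i : ℝ)) ≤ 2 * m * lpNormVec 2 (fun i => (k i : ℝ)) := by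
  classical
  obtain ⟨V, hV, hVc⟩ := exists_finset_int_vectors hL hn
  let ν : (Fin n → ℤ) → ℝ := fun k => lpNormVec 2 fun i => (k i : ℝ)
  let y : (Fin n → ℤ) → Fin n → ℝ := fun k i => k i / ν k
  have hν : ∀ k ≠ 0, 0 < ν k := by
    intro k hk
    obtain ⟨i, hi⟩ := Function.ne_iff.1 hk
    simp only [ν, lpNormVec_two_eq]
    refine Real.sqrt_pos.2 (Finset.sum_pos' (fun _ _ => sq_nonneg _) ⟨i, Finset.mem_univ _, ?_⟩)
    have : (k i : ℝ) ≠ 0 := by exact_mod_cast hi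
    positivity
  obtain ⟨ω, hω⟩ := exists_signs (m := m) ((V.erase 0).image y) (by
    intro x hx
    obtain ⟨k, hk, rfl⟩ := Finset.mem_image.1 hx
    have h0 := hν k (Finset.ne_of_mem_erase hk)
    have h1 : ν k ^ 2 = ∑ i, (k i : ℝ) ^ 2 := by
      simp only [ν, lpNormVec_two_eq]
      exact Real.sq_sqrt (Finset.sum_nonneg fun _ _ => sq_nonneg _)
    simp only [y, div_pow]
    rw [← Finset.sum_div, ← h1, div_self (by positivity)]) (by
    have h1 : (((V.erase 0).image y).card : ℝ) ≤ V.card := by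
      exact_mod_cast Finset.card_image_le.trans (Finset.card_erase_le)
    refine lt_of_le_of_lt ?_ hm
    gcongr
    exact h1.trans hVc)
  refine ⟨Matrix.of fun j i => boolSign (ω j i), fun k hk => ?_⟩
  rcases eq_or_ne k 0 with rfl | hk0
  · have e : (fun i => (((0 : Fin n → ℤ) i : ℤ) : ℝ)) = 0 := by ext; simp
    rw [e, Matrix.mulVec_zero]
    simp [lpNormVec_zero]
  · have h0 := hν k hk0
    have h := hω (y k) (Finset.mem_image.2 ⟨k, Finset.mem_erase.2 ⟨hk0, hV k hk⟩, rfl⟩)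
    have e : lpNormVec 1 ((Matrix.of fun j i => boolSign (ω j i)) *ᵥ
        fun i => (k i : ℝ)) = (∑ j, |signSum (y k) (ω j)|) * ν k := by
      rw [lpNormVec_one_eq, Finset.sum_mul]
      refine Finset.sum_congr rfl fun j _ => ?_
      rw [← abs_of_pos h0, ← abs_mul]
      congr 1
      simp only [Matrix.mulVec, dotProduct, Matrix.of_apply, signSum, y]
      rw [Finset.sum_mul]
      refine Finset.sum_congr rfl fun i _ => ?_
      field_simp
    rw [e]
    exact ⟨mul_le_mul_of_nonneg_right h.1 h0.le, mul_le_mul_of_nonneg_right h.2 h0.le⟩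

/-- Kernel vectors are rescaled to `ℓ₁` norm `L`; the distortion bounds `m / 16` and `2 m` give the
constant `33 = 1 + 32`. -/
theorem exists_matrix_kernel_bound {m n L : ℕ} (hL : 0 < L) (hn : 2 * L ≤ n) (hm0 : 0 < m)
    (hm : 2 * Real.exp (L * (4 + Real.log (n / L))) * (15 / 16 : ℝ) ^ m < 1) {ε : ℝ}
    (hε : 33 ≤ ε * √L) :
    ∃ A : Matrix (Fin m) (Fin n) ℝ,
      ∀ z : Fin n → ℝ, A *ᵥ z = 0 → lpNormVec 2 z ≤ ε * lpNormVec 1 z := by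
  obtain ⟨A, hA⟩ := exists_matrix_int_vectors hL hn hm
  refine ⟨A, fun z hz => ?_⟩
  have hm' : (0 : ℝ) < m := by exact_mod_cast hm0
  have hL' : (0 : ℝ) < L := by exact_mod_cast hL
  rcases eq_or_ne z 0 with rfl | hz0
  · simp [lpNormVec_zero]
  have hpos : 0 < lpNormVec 1 z := by
    simpa [lpNormVec] using hz0
  have h := lpNormVec_two_le_of_mulVec_eq_zero A (by positivity) (by positivity) hA
    ((L / lpNormVec 1 z) • z)
    (by rw [lpNormVec_smul, abs_of_pos (by positivity), div_mul_cancel₀ _ hpos.ne'])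
    (by rw [Matrix.mulVec_smul, hz, smul_zero])
  rw [lpNormVec_smul, abs_of_pos (by positivity), div_mul_eq_mul_div, div_le_iff₀ hpos] at h
  have e : (1 + 2 * (m : ℝ) / (m / 16)) = 33 := by field_simp; norm_num
  rw [e] at h
  refine le_of_mul_le_mul_left ?_ hL'
  calc _ ≤ 33 * √L * lpNormVec 1 z := h
    _ ≤ (ε * √L) * √L * lpNormVec 1 z := by gcongr
    _ = (√L * √L) * (ε * lpNormVec 1 z) := by ring
    _ = _ := by rw [Real.mul_self_sqrt hL'.le]

theorem exists_sketch_kernel_bound {n : ℕ} {ε : ℝ} (hε : 0 < ε)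
    (hε2 : ε < 1 / 2) (hn : 1 / ε ^ 2 < (n : ℝ) / 2) :
    ∃ m : ℕ, (m : ℝ) ≤ 160000 * (1 / ε ^ 2 * Real.log (ε ^ 2 * n)) ∧
      ∃ A : Matrix (Fin m) (Fin n) ℝ,
        ∀ z : Fin n → ℝ, A *ᵥ z = 0 → lpNormVec 2 z ≤ ε * lpNormVec 1 z := by
  have hε0 : 0 < ε ^ 2 := by positivity
  set N : ℝ := ε ^ 2 * n with hN
  have hN2 : 2 < N := by
    rw [div_lt_iff₀ hε0] at hn
    rw [hN]; linarith
  set u : ℝ := 1 / ε ^ 2 with hu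
  have hu1 : 1 < u := by
    rw [hu, lt_div_iff₀ hε0]
    nlinarith
  have hlog : 1 / 2 ≤ Real.log N :=
    le_trans (by linarith [Real.log_two_gt_d9]) (Real.log_le_log (by norm_num) hN2.le)
  set l : ℝ := Real.log N
  -- `1089 = 33²`, so that `ε √L ≥ 33`.
  set L : ℕ := ⌈1089 * u⌉₊ with hLdef
  have hL1 : 1089 * u ≤ L := Nat.le_ceil _
  have hL2 : (L : ℝ) ≤ 1090 * u := by
    linarith [Nat.ceil_lt_add_one (show 0 ≤ 1089 * u by linarith)]
  have hL' : (0 : ℝ) < L := by linarith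
  have hL : 0 < L := by exact_mod_cast hL'
  have hul : u / 2 ≤ u * l := by nlinarith
  -- Counting integer points needs `2 L ≤ n`. Otherwise `n = O(ε⁻²)`, and the identity matrix is
  -- small enough because `log N ≥ 1/2`.
  rcases lt_or_ge n (2 * L) with hlt | hge
  · refine ⟨n, ?_, 1, fun z hz => ?_⟩
    · have : (n : ℝ) ≤ 2 * L := by exact_mod_cast hlt.le
      linarith
    · rw [Matrix.one_mulVec] at hz
      simp [hz, lpNormVec_zero]
  · have hn0 : (0 : ℝ) < n := by
      have : (2 : ℝ) * L ≤ n := by exact_mod_cast hge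
      linarith
    have hlogL : Real.log (n / L) ≤ l := by
      refine Real.log_le_log (by positivity) ?_
      rw [div_le_iff₀ hL']
      have e : N * u = n := by rw [hN, hu]; field_simp
      nlinarith
    set X : ℝ := L * (4 + Real.log (n / L)) with hX
    have hlog0 : 0 ≤ Real.log (n / L) := by
      refine Real.log_nonneg ?_
      rw [le_div_iff₀ hL']
      have : (2 : ℝ) * L ≤ n := by exact_mod_cast hge
      linarith
    have hX0 : 0 ≤ X := by positivity
    have hX1 : X ≤ 1090 * u * (9 * l) := by
      rw [hX]
      gcongr
      linarith
    -- With `m ≥ 16 (1 + X)` rows, `(15/16) ^ m ≤ exp (-1 - X)`, so the union bound is at most `2 /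
    -- e < 1`.
    have hm1 := Nat.le_ceil (16 * (1 + X))
    have hm2 := Nat.ceil_lt_add_one (show 0 ≤ 16 * (1 + X) by linarith)
    set m : ℕ := ⌈16 * (1 + X)⌉₊
    refine ⟨m, by linarith, exists_matrix_kernel_bound hL hge ?_ ?_ ?_⟩
    · have : (0 : ℝ) < m := by linarith
      exact_mod_cast this
    · have h1 : (15 / 16 : ℝ) ^ m ≤ Real.exp (-(m / 16)) := by
        have h2 : (15 / 16 : ℝ) ≤ Real.exp (-(1 / 16)) := by
          linarith [Real.add_one_le_exp (-(1 / 16) : ℝ)]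
        calc (15 / 16 : ℝ) ^ m ≤ Real.exp (-(1 / 16)) ^ m := by gcongr
          _ = _ := by rw [← Real.exp_nat_mul]; ring_nf
      calc 2 * Real.exp X * (15 / 16 : ℝ) ^ m ≤ 2 * Real.exp X * Real.exp (-(m / 16)) := by gcongr
        _ = 2 * Real.exp (X - m / 16) := by rw [mul_assoc, ← Real.exp_add]; rfl
        _ ≤ 2 * Real.exp (-1) := by
          gcongr
          linarith
        _ < 1 := by
          rw [Real.exp_neg, ← div_eq_mul_inv, div_lt_one (Real.exp_pos _)]
          linarith [Real.exp_one_gt_d9]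
    · rw [← Real.sqrt_sq hε.le, ← Real.sqrt_mul (sq_nonneg _)]
      refine Real.le_sqrt_of_sq_le ?_
      calc (33 : ℝ) ^ 2 = ε ^ 2 * (1089 * u) := by rw [hu]; field_simp; norm_num
        _ ≤ _ := by gcongr

theorem mainTheorem3 :
    ∃ c C : ℝ, 0 < c ∧ 0 < C ∧
      ∀ (n : ℕ) (ε : ℝ), 0 < ε → ε < 1 / 2 → 1 / ε ^ 2 < (n : ℝ) / 2 →
        (∃ m : ℕ, (m : ℝ) ≤ C * (1 / ε ^ 2 * Real.log (ε ^ 2 * (n : ℝ))) ∧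
          ∃ (A : Matrix (Fin m) (Fin n) ℝ) (Out : (Fin m → ℝ) → ℝ),
            SolvesL2NormEstimation A Out ε) ∧
        (∀ m : ℕ, (m : ℝ) < c * (1 / ε ^ 2 * Real.log (ε ^ 2 * (n : ℝ))) →
          ¬ ∃ (A : Matrix (Fin m) (Fin n) ℝ) (Out : (Fin m → ℝ) → ℝ),
            SolvesL2NormEstimation A Out ε) := by
  refine ⟨1 / 128, 160000, by norm_num, by norm_num, fun n ε hε hε2 hn => ⟨?_, ?_⟩⟩
  · obtain ⟨m, hm, A, hA⟩ := exists_sketch_kernel_bound hε hε2 hn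
    exact ⟨m, hm, A, (exists_solvesL2NormEstimation_iff A hε.le).2 hA⟩
  · rintro m hm ⟨A, hOut⟩
    have hA := (exists_solvesL2NormEstimation_iff A hε.le).1 hOut
    exact hm.not_ge (rows_ge_of_kernel_bound A hε hε2 hn hA)
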